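/- For real $s>1$ let $\mathrm{Zeta}(s)$ be the probability distribution on $\{1,2,3,\dots\}$ giving mass $\frac{1}{m^{s}\zeta(s)}$ to $m$, where $\zeta(s)=\sum_{m\ge 1}m^{-s}$. Let $\omega(m)$ be the number of distinct prime factors of $m$, and let $Z$ be a standard normal random variable. Let $(a_j)$ be a sequence of positive real numbers with $a_j\to\infty$, and for each $j$ let $X_j$ be a $\mathrm{Zeta}(1+1/a_j)$-distributed random variable (the $X_j$ may live on different probability spaces). Put $\mu_j=\sum_{p}p^{-(1+1/a_j)}$, the sum running over all primes $p$. Then: 1. for every $j$ the series $\mu_j$ converges, $\omega(X_j)$ is integrable, and $\mathbb{E}\,\omega(X_j)=\mu_j$; 2. $\mu_j\to\infty$ as $j\to\infty$; 3. $\dfrac{\omega(X_j)-\mu_j}{\sqrt{\mu_j}}$ converges in distribution to $Z$ as $j\to\infty$; equivalently, for every $x\in\mathbb{R}$, $\mathbb{P}\bigl(\omega(X_j)-\mu_j\le x\sqrt{\mu_j}\bigr)\to\mathbb{P}(Z\le x)$. In particular (the theorem of Peltzer and Cranston), if $X_s$ is $\mathrm{Zeta}(s)$-distributed for $s>1$,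 then for every $x\in\mathbb{R}$, $\mathbb{P}\bigl(\omega(X_s)-\sum_p p^{-s}\le x\sqrt{\textstyle\sum_p p^{-s}}\bigr)\to\mathbb{P}(Z\le x)$ as $s\downarrow 1$. -/

import Mathlib

open Filter Topology MeasureTheory ProbabilityTheory

noncomputable section

/-- The value `ζ(s) = ∑_{j ≥ 1} j^{-s}` of the zeta function at a real number `s > 1`. -/
def zetaSeries (s : ℝ) : ℝ := ∑' j : ℕ, 1 / ((j + 1 : ℕ) : ℝ) ^ s

/-- The point mass `1 / (j^s ζ(s))` of the `Zeta(s)` distribution at `j ≥ 1`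
(there is no mass at `0`). -/
def zetaMass (s : ℝ) (j : ℕ) : ℝ := if j = 0 then 0 else 1 / ((j : ℝ) ^ s * zetaSeries s)

/-- The `Zeta(s)` distribution, `s > 1`, as a measure on the natural numbers. -/
def zetaDistribution (s : ℝ) : Measure ℕ :=
  Measure.sum fun j : ℕ => ENNReal.ofReal (zetaMass s j) • Measure.dirac j

/-- The sum `∑_p p^{-s}` over all primes `p`. -/
def primeSum (s : ℝ) : ℝ := ∑' p : Nat.Primes, (p : ℝ) ^ (-s)

lemma zetaDistribution_singleton (s : ℝ) (j : ℕ) :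
    zetaDistribution s {j} = ENNReal.ofReal (zetaMass s j) := by
  rw [zetaDistribution, Measure.sum_apply _ (measurableSet_singleton j), tsum_eq_single j]
  · simp
  · intro i hi
    simp [hi]

lemma zetaDistribution_isProbabilityMeasure {s : ℝ} (hs : 1 < s) :
    IsProbabilityMeasure (zetaDistribution s) := by
  have hsum : Summable fun j : ℕ => 1 / ((j + 1 : ℕ) : ℝ) ^ s :=
    (summable_nat_add_iff 1).2 (Real.summable_one_div_nat_rpow.2 hs)
  have hpos : 0 < zetaSeries s := by
    exact hsum.tsum_pos (fun j => by positivity) 0 (by positivity)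
  have hmass : HasSum (fun j : ℕ => zetaMass s (j + 1)) 1 := by
    have h := hsum.hasSum.div_const (zetaSeries s)
    have h1 : (∑' j : ℕ, 1 / ((j + 1 : ℕ) : ℝ) ^ s) / zetaSeries s = 1 := div_self hpos.ne'
    rw [h1] at h
    have h2 : (fun j : ℕ => zetaMass s (j + 1)) =
        fun j : ℕ => 1 / ((j + 1 : ℕ) : ℝ) ^ s / zetaSeries s := by
      funext j
      rw [zetaMass, if_neg (Nat.succ_ne_zero j), div_div]
    rw [h2]
    exact h
  have hmass' : HasSum (zetaMass s) 1 := by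
    have h := (hasSum_nat_add_iff (f := zetaMass s) 1).1 hmass
    simpa [zetaMass] using h
  have hnn : ∀ j, 0 ≤ zetaMass s j := by
    intro j
    unfold zetaMass
    split_ifs
    · exact le_rfl
    · positivity
  refine ⟨?_⟩
  rw [zetaDistribution, Measure.sum_apply _ MeasurableSet.univ]
  simp only [Measure.smul_apply, measure_univ, smul_eq_mul, mul_one]
  rw [← ENNReal.ofReal_tsum_of_nonneg hnn hmass'.summable, hmass'.tsum_eq, ENNReal.ofReal_one]

end

/-! Under `Zeta(s)`, `ω` behaves like a sum of independent Bernoulli variables with parameters `p ^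
(-s)`. Independence is never used explicitly: the Euler product gives `E z ^ ω = ∏ (1 + (z - 1) p ^
(-s))`. For `‖z‖ ≤ 1` and `‖z - 1‖ ≤ 1` this differs from the Poisson generating function `exp ((z -
1) μ)`, `μ = ∑ p ^ (-s)`, by at most `‖z - 1‖ ^ 2 ∑ p ^ (-2)`, uniformly in `s`. As `s ↓ 1`,
divergence of `∑ 1 / p` gives `μ → ∞`, so `z = exp (i t / √μ)` tends to `1` and the error vanishes.
The standardized Poisson characteristic function tends to `exp (-t ^ 2 / 2)`, and Lévy's continuity
theorem concludes. -/

lemma norm_prod_sub_prod_le_sum_norm_sub {ι : Type*} (S : Finset ι) {f g : ι → ℂ}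
    (hf : ∀ i, ‖f i‖ ≤ 1) (hg : ∀ i, ‖g i‖ ≤ 1) :
    ‖∏ i ∈ S, f i - ∏ i ∈ S, g i‖ ≤ ∑ i ∈ S, ‖f i - g i‖ := by
  classical
  induction S using Finset.induction_on with
  | empty => simp
  | insert i S hi ih =>
    rw [Finset.prod_insert hi, Finset.prod_insert hi, Finset.sum_insert hi]
    have hG : ‖∏ i ∈ S, g i‖ ≤ 1 := by
      rw [norm_prod]; exact Finset.prod_le_one (fun _ _ => norm_nonneg _) fun i _ => hg i
    -- Telescoping: exchange one factor at a time, all others having norm at most `1`.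
    calc ‖f i * ∏ i ∈ S, f i - g i * ∏ i ∈ S, g i‖
        = ‖(f i - g i) * ∏ i ∈ S, g i + f i * (∏ i ∈ S, f i - ∏ i ∈ S, g i)‖ := by ring_nf
      _ ≤ ‖f i - g i‖ * ‖∏ i ∈ S, g i‖ + ‖f i‖ * ‖∏ i ∈ S, f i - ∏ i ∈ S, g i‖ := by
        refine (norm_add_le _ _).trans ?_
        rw [norm_mul, norm_mul]
      _ ≤ ‖f i - g i‖ * 1 + 1 * ∑ i ∈ S, ‖f i - g i‖ := by
        gcongr
        exact hf i
      _ = _ := by ring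

lemma norm_hasProd_sub_hasProd_le_tsum {ι : Type*} {f g : ι → ℂ} {a b : ℂ}
    (hf : ∀ i, ‖f i‖ ≤ 1) (hg : ∀ i, ‖g i‖ ≤ 1) (ha : HasProd f a) (hb : HasProd g b)
    {c : ι → ℝ} (hc : Summable c) (h : ∀ i, ‖f i - g i‖ ≤ c i) :
    ‖a - b‖ ≤ ∑' i, c i := by
  refine le_of_tendsto' (Tendsto.sub ha hb).norm fun S => ?_
  refine (norm_prod_sub_prod_le_sum_norm_sub S hf hg).trans ?_
  exact (Finset.sum_le_sum fun i _ => h i).trans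
    (hc.sum_le_tsum S fun i _ => (norm_nonneg _).trans (h i))

/-! ### Euler product and generating function of `ω` -/

lemma zetaSeries_eq_tsum_rpow_neg {s : ℝ} (hs : 1 < s) :
    zetaSeries s = ∑' n : ℕ, (n : ℝ) ^ (-s) := by
  have h : Summable fun n : ℕ => (n : ℝ) ^ (-s) := Real.summable_nat_rpow.2 (by linarith)
  rw [h.tsum_eq_zero_add, zetaSeries, Nat.cast_zero, Real.zero_rpow (by linarith), zero_add]
  refine tsum_congr fun j => ?_
  rw [Real.rpow_neg (by positivity), one_div]

lemma zetaMass_eq {s : ℝ} (hs : 1 < s) (n : ℕ) :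
    zetaMass s n = (n : ℝ) ^ (-s) / zetaSeries s := by
  unfold zetaMass
  split_ifs with h
  · rw [h, Nat.cast_zero, Real.zero_rpow (by linarith), zero_div]
  · rw [Real.rpow_neg (by positivity), one_div, mul_inv, div_eq_mul_inv]

lemma zetaSeries_nonneg (s : ℝ) : 0 ≤ zetaSeries s := tsum_nonneg fun _ => by positivity

lemma zetaMass_nonneg (s : ℝ) (n : ℕ) : 0 ≤ zetaMass s n := by
  have := zetaSeries_nonneg s
  unfold zetaMass
  split_ifs <;> positivity

lemma zetaMass_mul {s : ℝ} (hs : 1 < s) (m n : ℕ) :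
    zetaMass s (m * n) = (m : ℝ) ^ (-s) * zetaMass s n := by
  rw [zetaMass_eq hs, zetaMass_eq hs, Nat.cast_mul,
    Real.mul_rpow (by positivity) (by positivity), mul_div_assoc]

lemma prime_rpow_neg_lt_one {s : ℝ} (hs : 1 < s) {p : ℕ} (hp : p.Prime) :
    (p : ℝ) ^ (-s) < 1 :=
  Real.rpow_lt_one_of_one_lt_of_neg (by exact_mod_cast hp.one_lt) (by linarith)

open ArithmeticFunction in
/-- The Euler product of `∑ z ^ ω(n) n ^ (-s)`. -/
lemma hasProd_pow_cardDistinctFactors_mul_rpow {s : ℝ} (hs : 1 < s) {z : ℂ} (hz : ‖z‖ ≤ 1) :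
    HasProd (fun p : Nat.Primes => (1 + (z - 1) * ((p : ℝ) ^ (-s) : ℝ)) /
        (1 - ((p : ℝ) ^ (-s) : ℝ) : ℂ))
      (∑' n : ℕ, z ^ cardDistinctFactors n * ((n : ℝ) ^ (-s) : ℝ)) := by
  set f : ℕ → ℂ := fun n => z ^ cardDistinctFactors n * ((n : ℝ) ^ (-s) : ℝ) with hf
  have hsum : Summable fun n => ‖f n‖ := by
    refine Summable.of_nonneg_of_le (fun _ => norm_nonneg _) (fun n => ?_)
      (Real.summable_nat_rpow.2 (show -s < -1 by linarith))
    rw [hf, norm_mul, norm_pow, Complex.norm_real, Real.norm_of_nonneg (by positivity)]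
    exact mul_le_of_le_one_left (by positivity) (pow_le_one₀ (norm_nonneg _) hz)
  have key := EulerProduct.eulerProduct_hasProd (f := f) (by simp [hf])
    (fun {m n} hmn => by
      simp only [hf]
      rw [cardDistinctFactors_mul hmn, pow_add, Nat.cast_mul,
        Real.mul_rpow (by positivity) (by positivity), Complex.ofReal_mul]
      ring) hsum (by simp [hf, Real.zero_rpow (show -s ≠ 0 by linarith)])
  convert key using 2 with p
  set q : ℝ := (p : ℝ) ^ (-s) with hq
  have hq0 : 0 ≤ q := by positivity
  have hq1 : q < 1 := prime_rpow_neg_lt_one hs p.2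
  -- `ω` equals `1` on every positive power of `p`, so the Euler factor is `1 + z q / (1 - q)`.
  have hterm : ∀ e : ℕ, f ((p : ℕ) ^ (e + 1)) = z * q * (q : ℂ) ^ e := by
    intro e
    simp only [hf]
    rw [cardDistinctFactors_apply_prime_pow p.2 (Nat.succ_ne_zero e), Nat.cast_pow,
      ← Real.rpow_natCast, ← Real.rpow_mul (by positivity), mul_comm, mul_comm ((e + 1 : ℕ) : ℝ),
      Real.rpow_mul (by positivity), Real.rpow_natCast, ← hq]
    push_cast
    ring
  have hn : ‖(q : ℂ)‖ < 1 := by rwa [Complex.norm_real, Real.norm_of_nonneg hq0]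
  have hgeo := (hasSum_geometric_of_norm_lt_one hn).mul_left (z * q)
  have hsum' : Summable fun e : ℕ => f ((p : ℕ) ^ e) := by
    rw [← summable_nat_add_iff 1]
    simp only [hterm]
    exact hgeo.summable
  rw [hsum'.tsum_eq_zero_add]
  simp only [hterm]
  rw [hgeo.tsum_eq]
  have h1 : (1 - q : ℂ) ≠ 0 := by
    rw [sub_ne_zero]; exact_mod_cast hq1.ne'
  simp only [pow_zero, hf]
  field_simp
  simp
  ring

lemma integrable_pow_cardDistinctFactors {s : ℝ} (hs : 1 < s) {z : ℂ} (hz : ‖z‖ ≤ 1) :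
    Integrable (fun n : ℕ => z ^ ArithmeticFunction.cardDistinctFactors n)
      (zetaDistribution s) := by
  have := zetaDistribution_isProbabilityMeasure hs
  refine Integrable.of_bound (by fun_prop) 1 (ae_of_all _ fun n => ?_)
  rw [norm_pow]
  exact pow_le_one₀ (norm_nonneg _) hz

/-- The probability generating function of `ω` under `Zeta(s)` is that of a sum of independent
Bernoulli variables with parameters `p ^ (-s)`. -/
lemma hasProd_integral_pow_cardDistinctFactors {s : ℝ} (hs : 1 < s) {z : ℂ} (hz : ‖z‖ ≤ 1) :
    HasProd (fun p : Nat.Primes => 1 + (z - 1) * ((p : ℝ) ^ (-s) : ℝ))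
      (∫ n, z ^ ArithmeticFunction.cardDistinctFactors n ∂(zetaDistribution s)) := by
  have h1 := hasProd_pow_cardDistinctFactors_mul_rpow hs hz
  -- `z = 1` is the Euler product of `ζ(s)`; dividing by it cancels the denominators `1 - p ^ (-s)`.
  have h2 := hasProd_pow_cardDistinctFactors_mul_rpow hs (z := 1) (by simp)
  simp only [one_pow, one_mul, sub_self, zero_mul, add_zero, ← Complex.ofReal_tsum,
    ← zetaSeries_eq_tsum_rpow_neg hs] at h2
  have hne : zetaSeries s ≠ 0 := by
    intro h0
    have := zetaDistribution_isProbabilityMeasure hs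
    have hz : zetaDistribution s = 0 := by
      simp [zetaDistribution, zetaMass, h0]
    exact IsProbabilityMeasure.ne_zero (zetaDistribution s) hz
  have h3 : Tendsto _ _ _ := Tendsto.div h1 h2 (by exact_mod_cast hne)
  rw [integral_countable (integrable_pow_cardDistinctFactors hs hz)]
  have hval : ∑' n : ℕ, (zetaDistribution s).real {n} •
        z ^ ArithmeticFunction.cardDistinctFactors n =
      (∑' n : ℕ, z ^ ArithmeticFunction.cardDistinctFactors n * ((n : ℝ) ^ (-s) : ℝ)) /
        (zetaSeries s : ℂ) := by
    rw [← tsum_div_const]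
    refine tsum_congr fun n => ?_
    rw [measureReal_def, zetaDistribution_singleton, ENNReal.toReal_ofReal (zetaMass_nonneg s n),
      zetaMass_eq hs, Complex.real_smul]
    push_cast
    ring
  rw [hval]
  refine h3.congr fun S => ?_
  simp only [Pi.div_apply]
  rw [← Finset.prod_div_distrib]
  refine Finset.prod_congr rfl fun p _ => ?_
  have hq1 := prime_rpow_neg_lt_one hs p.2
  have : (1 - ((p : ℝ) ^ (-s) : ℝ) : ℂ) ≠ 0 := by
    rw [sub_ne_zero]; exact_mod_cast hq1.ne'
  field_simp

/-! ### Poisson approximation -/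

lemma summable_prime_rpow_neg {s : ℝ} (hs : 1 < s) :
    Summable fun p : Nat.Primes => (p : ℝ) ^ (-s) := Nat.Primes.summable_rpow.2 (by linarith)

/-- Compare the factors `1 + w` and `exp w` for `w = (z - 1) p ^ (-s)`: they differ by at most `‖w‖
^ 2`, and `p ^ (-2 s) ≤ p ^ (-2)` removes the dependence on `s`. -/
lemma norm_integral_pow_cardDistinctFactors_sub_exp_le {s : ℝ} (hs : 1 < s) {z : ℂ}
    (hz : ‖z‖ ≤ 1) (hz1 : ‖z - 1‖ ≤ 1) :
    ‖∫ n, z ^ ArithmeticFunction.cardDistinctFactors n ∂(zetaDistribution s) -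
        Complex.exp ((z - 1) * primeSum s)‖ ≤
      ‖z - 1‖ ^ 2 * ∑' p : Nat.Primes, (p : ℝ) ^ (-2 : ℝ) := by
  have hexp : HasProd (fun p : Nat.Primes => Complex.exp ((z - 1) * ((p : ℝ) ^ (-s) : ℝ)))
      (Complex.exp ((z - 1) * primeSum s)) :=
    ((Complex.hasSum_ofReal.2 (summable_prime_rpow_neg hs).hasSum).mul_left (z - 1)).cexp
  have hre : (z - 1).re ≤ 0 := by
    simpa using (Complex.re_le_norm z).trans hz
  rw [← tsum_mul_left]
  refine norm_hasProd_sub_hasProd_le_tsum (fun p => ?_) (fun p => ?_)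
    (hasProd_integral_pow_cardDistinctFactors hs hz) hexp
    ((Nat.Primes.summable_rpow.2 (by norm_num)).mul_left _) (fun p => ?_)
  all_goals
    have hq1 := prime_rpow_neg_lt_one hs p.2
    have hq0 : 0 ≤ (p : ℝ) ^ (-s) := by positivity
  · generalize (p : ℝ) ^ (-s) = q at *
    -- A convex combination of `1` and `z`, hence in the unit disc.
    calc ‖1 + (z - 1) * q‖ = ‖((1 - q : ℝ) : ℂ) + z * q‖ := by push_cast; ring_nf
      _ ≤ (1 - q) + ‖z‖ * q := by
        refine (norm_add_le _ _).trans_eq ?_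
        rw [norm_mul, Complex.norm_real, Complex.norm_real, Real.norm_of_nonneg hq0,
          Real.norm_of_nonneg (by linarith)]
      _ ≤ 1 := by nlinarith
  · rw [Complex.norm_exp, Complex.re_mul_ofReal, Real.exp_le_one_iff]
    exact mul_nonpos_of_nonpos_of_nonneg hre hq0
  · have hw : ‖(z - 1) * ((p : ℝ) ^ (-s) : ℝ)‖ = ‖z - 1‖ * (p : ℝ) ^ (-s) := by
      rw [norm_mul, Complex.norm_real, Real.norm_of_nonneg hq0]
    have := Complex.norm_exp_sub_one_sub_id_le (x := (z - 1) * ((p : ℝ) ^ (-s) : ℝ))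
      (by rw [hw]; exact mul_le_one₀ hz1 hq0 hq1.le)
    rw [norm_sub_rev, ← sub_sub]
    refine this.trans ?_
    rw [hw, mul_pow, ← Real.rpow_natCast (_ ^ _), ← Real.rpow_mul (by positivity)]
    gcongr
    · exact_mod_cast p.2.one_lt.le
    · push_cast; linarith

lemma primeSum_pos {s : ℝ} (hs : 1 < s) : 0 < primeSum s :=
  (summable_prime_rpow_neg hs).tsum_pos (fun _ => by positivity) ⟨2, Nat.prime_two⟩
    (by positivity)

/-- Some finite partial sum of `∑ 1 / p` exceeds `M`, and it is continuous in `s`. -/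
lemma tendsto_primeSum_atTop : Tendsto primeSum (𝓝[>] 1) atTop := by
  rw [tendsto_atTop]
  intro M
  have hns : ¬ Summable fun p : Nat.Primes => (p : ℝ) ^ (-1 : ℝ) := by
    rw [Nat.Primes.summable_rpow]; simp
  obtain ⟨S, hS⟩ : ∃ S : Finset Nat.Primes, M < ∑ p ∈ S, (p : ℝ) ^ (-1 : ℝ) := by
    by_contra! h
    exact hns (summable_of_sum_le (fun _ => by positivity) h)
  have hcont : Tendsto (fun s : ℝ => ∑ p ∈ S, (p : ℝ) ^ (-s)) (𝓝[>] 1)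
      (𝓝 (∑ p ∈ S, (p : ℝ) ^ (-1 : ℝ))) := by
    refine tendsto_nhdsWithin_of_tendsto_nhds (tendsto_finsetSum _ fun p _ => ?_)
    exact tendsto_const_nhds.rpow (tendsto_neg 1) (Or.inl (by exact_mod_cast p.2.ne_zero))
  filter_upwards [hcont.eventually (lt_mem_nhds hS), self_mem_nhdsWithin] with s h hs
  exact h.le.trans ((summable_prime_rpow_neg hs).sum_le_tsum S fun _ _ => by positivity)

/-- Taylor expansion behind the normal approximation of the Poisson distribution. -/
lemma tendsto_mul_exp_sub_one_sub (t : ℝ) :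
    Tendsto (fun r : ℝ => (Complex.exp ((t / r : ℝ) * Complex.I) - 1) * (r ^ 2 : ℝ)
      - (t * r : ℝ) * Complex.I) atTop (𝓝 (-(t ^ 2 / 2 : ℝ) : ℂ)) := by
  rw [tendsto_iff_norm_sub_tendsto_zero]
  have h0 : Tendsto (fun r : ℝ => |t| ^ 3 / r) atTop (𝓝 0) :=
    tendsto_const_nhds.div_atTop tendsto_id
  refine squeeze_zero' (Eventually.of_forall fun _ => norm_nonneg _) ?_ h0
  filter_upwards [eventually_ge_atTop |t|, eventually_gt_atTop 0] with r hr hr0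
  set x : ℂ := (t / r : ℝ) * Complex.I with hx
  have hxn : ‖x‖ = |t| / r := by
    rw [hx, norm_mul, Complex.norm_I, mul_one, Complex.norm_real, Real.norm_eq_abs, abs_div,
      abs_of_pos hr0]
  have hb := Complex.exp_bound (x := x) (by rw [hxn]; exact (div_le_one hr0).2 hr)
    (n := 3) (by norm_num)
  have hr' : (r : ℂ) ≠ 0 := by exact_mod_cast hr0.ne'
  have heq : (Complex.exp x - 1) * (r ^ 2 : ℝ) - (t * r : ℝ) * Complex.I - -(t ^ 2 / 2 : ℝ) =
      (Complex.exp x - ∑ m ∈ Finset.range 3, x ^ m / (m.factorial : ℂ)) * (r ^ 2 : ℝ) := by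
    simp only [Finset.sum_range_succ, Finset.sum_range_zero, Nat.factorial]
    have h2 : x ^ 2 * r ^ 2 = -(t : ℂ) ^ 2 := by
      rw [hx, mul_pow, Complex.I_sq]; push_cast; field_simp
    have h1 : x * r = t * Complex.I := by
      rw [hx]; push_cast; field_simp
    push_cast
    clear_value x
    linear_combination (r : ℂ) * h1 + (1 / 2) * h2
  rw [heq, norm_mul, Complex.norm_real, Real.norm_of_nonneg (by positivity)]
  -- The constant `4 / 18` of `Complex.exp_bound` is rounded up to `1`.
  calc _ ≤ (|t| / r) ^ 3 * 1 * r ^ 2 := by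
        rw [hxn] at hb
        gcongr
        refine hb.trans ?_
        gcongr
        norm_num [Nat.factorial]
    _ = _ := by field_simp

/-! ### The mean of `ω` -/

lemma zetaDistribution_setOf_dvd {s : ℝ} (hs : 1 < s) {d : ℕ} (hd : d ≠ 0) :
    zetaDistribution s {n | d ∣ n} = ENNReal.ofReal ((d : ℝ) ^ (-s)) := by
  have := zetaDistribution_isProbabilityMeasure hs
  have hU : {n | d ∣ n} = ⋃ k : ℕ, {d * k} := by
    ext n; simp [dvd_iff_exists_eq_mul_right, eq_comm]
  have h1 : ∑' k : ℕ, zetaDistribution s {k} = 1 := by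
    rw [← measure_iUnion (fun i j hij => by simpa using hij) fun _ => measurableSet_singleton _,
      Set.iUnion_of_singleton, measure_univ]
  rw [hU, measure_iUnion (fun i j hij => by simpa [hd] using hij)
    fun _ => measurableSet_singleton _]
  simp_rw [zetaDistribution_singleton] at h1 ⊢
  simp_rw [zetaMass_mul hs, ENNReal.ofReal_mul (show 0 ≤ (d : ℝ) ^ (-s) by positivity)]
  rw [ENNReal.tsum_mul_left, h1, mul_one]

/-- At `n = 0` this fails, since every prime divides `0`; but `0` carries no mass. -/
lemma cardDistinctFactors_eq_tsum_indicator {n : ℕ} (hn : n ≠ 0) :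
    (ArithmeticFunction.cardDistinctFactors n : ENNReal) =
      ∑' p : Nat.Primes, {m : ℕ | (p : ℕ) ∣ m}.indicator (fun _ => (1 : ENNReal)) n := by
  have h := tsum_subtype {p : ℕ | p.Prime}
    (fun p => {m : ℕ | p ∣ m}.indicator (fun _ => (1 : ENNReal)) n)
  refine Eq.trans ?_ h.symm
  rw [tsum_eq_sum (s := n.primeFactors)]
  · rw [ArithmeticFunction.cardDistinctFactors_apply, ← List.card_toFinset,
      Finset.sum_congr rfl (g := fun _ => (1 : ENNReal))]
    · rw [Finset.sum_const, nsmul_one]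
      rfl
    · intro p hp
      rw [Nat.mem_primeFactors] at hp
      simp [hp.1, hp.2.1]
  · intro p hp
    simp only [Nat.mem_primeFactors, not_and] at hp
    by_cases h1 : p.Prime
    · have : ¬ p ∣ n := fun h2 => hp h1 h2 hn
      simp [this]
    · simp [h1]

lemma lintegral_cardDistinctFactors {s : ℝ} (hs : 1 < s) :
    ∫⁻ n, (ArithmeticFunction.cardDistinctFactors n : ENNReal) ∂(zetaDistribution s) =
      ENNReal.ofReal (primeSum s) := by
  have hae : ∀ᵐ n ∂(zetaDistribution s), n ≠ 0 := by
    rw [ae_iff]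
    simp [zetaDistribution_singleton, zetaMass]
  rw [lintegral_congr_ae (hae.mono fun n hn => cardDistinctFactors_eq_tsum_indicator hn),
    lintegral_tsum fun p => (measurable_of_countable _).aemeasurable, primeSum,
    ENNReal.ofReal_tsum_of_nonneg (fun _ => by positivity) (summable_prime_rpow_neg hs)]
  refine tsum_congr fun p => ?_
  rw [lintegral_indicator_const (MeasurableSet.of_discrete), one_mul,
    zetaDistribution_setOf_dvd hs p.2.ne_zero]

lemma integrable_cardDistinctFactors {s : ℝ} (hs : 1 < s) :
    Integrable (fun n : ℕ => (ArithmeticFunction.cardDistinctFactors n : ℝ))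
      (zetaDistribution s) := by
  refine ⟨by fun_prop, ?_⟩
  rw [hasFiniteIntegral_iff_ofReal (ae_of_all _ fun _ => by positivity)]
  simp_rw [ENNReal.ofReal_natCast]
  rw [lintegral_cardDistinctFactors hs]
  exact ENNReal.ofReal_lt_top

lemma integral_cardDistinctFactors {s : ℝ} (hs : 1 < s) :
    ∫ n, (ArithmeticFunction.cardDistinctFactors n : ℝ) ∂(zetaDistribution s) = primeSum s := by
  rw [integral_eq_lintegral_of_nonneg_ae (ae_of_all _ fun _ => by positivity) (by fun_prop)]
  simp_rw [ENNReal.ofReal_natCast]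
  rw [lintegral_cardDistinctFactors hs, ENNReal.toReal_ofReal (primeSum_pos hs).le]

/-! ### Characteristic functions and convergence in distribution -/

/-- The standardization of `ω(n)` under the `Zeta(s)` distribution. -/
noncomputable def standardizedOmega (s : ℝ) (n : ℕ) : ℝ :=
  ((ArithmeticFunction.cardDistinctFactors n : ℝ) - primeSum s) / √(primeSum s)

lemma charFun_map_standardizedOmega {s : ℝ} (hs : 1 < s) (t : ℝ) :
    charFun ((zetaDistribution s).map (standardizedOmega s)) t =
      Complex.exp (-(t * √(primeSum s) : ℝ) * Complex.I) *
        ∫ n, Complex.exp ((t / √(primeSum s) : ℝ) * Complex.I) ^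
          ArithmeticFunction.cardDistinctFactors n ∂(zetaDistribution s) := by
  rw [charFun_apply_real, integral_map (by fun_prop) (by fun_prop), ← integral_const_mul]
  refine integral_congr_ae (ae_of_all _ fun n => ?_)
  have hr : 0 < √(primeSum s) := Real.sqrt_pos.2 (primeSum_pos hs)
  have hr2 : √(primeSum s) ^ 2 = primeSum s := Real.sq_sqrt (primeSum_pos hs).le
  simp only [standardizedOmega]
  rw [← Complex.exp_nat_mul, ← Complex.exp_add, ← hr2]
  generalize √(primeSum s) = r at *
  have : (r : ℂ) ≠ 0 := by exact_mod_cast hr.ne'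
  simp only [Real.sqrt_sq hr.le]
  congr 1
  push_cast
  field_simp
  ring

lemma tendsto_charFun_map_standardizedOmega (t : ℝ) :
    Tendsto (fun s => charFun ((zetaDistribution s).map (standardizedOmega s)) t) (𝓝[>] 1)
      (𝓝 (charFun (gaussianReal 0 1) t)) := by
  have hr : Tendsto (fun s => √(primeSum s)) (𝓝[>] 1) atTop :=
    Real.tendsto_sqrt_atTop.comp tendsto_primeSum_atTop
  have hlim : Tendsto (fun s => Complex.exp
      ((Complex.exp ((t / √(primeSum s) : ℝ) * Complex.I) - 1) * (√(primeSum s) ^ 2 : ℝ)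
      - (t * √(primeSum s) : ℝ) * Complex.I)) (𝓝[>] 1) (𝓝 (charFun (gaussianReal 0 1) t)) := by
    have h := (Complex.continuous_exp.tendsto _).comp ((tendsto_mul_exp_sub_one_sub t).comp hr)
    rw [charFun_gaussianReal]
    convert h using 2
    congr 1
    push_cast
    simp
  have hz : Tendsto (fun s => ‖Complex.exp ((t / √(primeSum s) : ℝ) * Complex.I) - 1‖) (𝓝[>] 1)
      (𝓝 0) := by
    have h1 : Tendsto (fun s => t / √(primeSum s)) (𝓝[>] 1) (𝓝 0) :=
      tendsto_const_nhds.div_atTop hr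
    have hc : Continuous fun x : ℝ => ‖Complex.exp (x * Complex.I) - 1‖ := by fun_prop
    have h2 := (hc.tendsto 0).comp h1
    rwa [Complex.ofReal_zero, zero_mul, Complex.exp_zero, sub_self, norm_zero] at h2
  have hdiff : Tendsto (fun s => charFun ((zetaDistribution s).map (standardizedOmega s)) t -
      Complex.exp ((Complex.exp ((t / √(primeSum s) : ℝ) * Complex.I) - 1) *
        (√(primeSum s) ^ 2 : ℝ) - (t * √(primeSum s) : ℝ) * Complex.I)) (𝓝[>] 1) (𝓝 0) := by
    have hb := (hz.pow 2).mul_const (∑' p : Nat.Primes, (p : ℝ) ^ (-2 : ℝ))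
    rw [zero_pow two_ne_zero, zero_mul] at hb
    refine squeeze_zero_norm' ?_ hb
    filter_upwards [self_mem_nhdsWithin, hz.eventually (ge_mem_nhds one_pos)] with s hs hs1
    -- The centring phase `exp (-i t √μ)` is common to both terms and has modulus `1`, so it drops
    -- out.
    rw [charFun_map_standardizedOmega hs, Real.sq_sqrt (primeSum_pos hs).le,
      sub_eq_neg_add ((Complex.exp _ - 1) * _), Complex.exp_add, ← neg_mul, ← mul_sub, norm_mul,
      ← Complex.ofReal_neg, Complex.norm_exp_ofReal_mul_I, one_mul]
    exact norm_integral_pow_cardDistinctFactors_sub_exp_le hs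
      (Complex.norm_exp_ofReal_mul_I _).le hs1
  simpa using hdiff.add hlim

lemma tendstoInDistribution_standardizedOmega {s : ℕ → ℝ} (hs : ∀ j, 1 < s j)
    (hlim : Tendsto s atTop (𝓝 1)) {Ω : ℕ → Type*} [∀ j, MeasurableSpace (Ω j)]
    (P : (j : ℕ) → Measure (Ω j)) [∀ j, IsProbabilityMeasure (P j)]
    (X : (j : ℕ) → Ω j → ℕ) (hX : ∀ j, HasLaw (X j) (zetaDistribution (s j)) (P j)) :
    TendstoInDistribution (fun j w => standardizedOmega (s j) (X j w)) atTop (id : ℝ → ℝ) P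
      (gaussianReal 0 1) := by
  have hmeas : ∀ j, Measurable (standardizedOmega (s j)) := fun j => measurable_of_countable _
  refine ⟨fun j => (hmeas j).comp_aemeasurable (hX j).aemeasurable, aemeasurable_id, ?_⟩
  refine ProbabilityMeasure.tendsto_iff_tendsto_charFun.2 fun t => ?_
  have h := (tendsto_charFun_map_standardizedOmega t).comp
    (tendsto_nhdsWithin_iff.2 ⟨hlim, Eventually.of_forall hs⟩)
  simp only [ProbabilityMeasure.coe_mk, Measure.map_id]
  refine h.congr fun j => ?_
  rw [Function.comp_apply, ← (hX j).map_eq,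
    AEMeasurable.map_map_of_aemeasurable (hmeas j).aemeasurable (hX j).aemeasurable]
  rfl

/-- The frontier `{x}` of the half-line is null for the Gaussian, so the portmanteau theorem
applies. -/
lemma tendsto_measureReal_Iic_of_tendstoInDistribution_gaussianReal {Ω : ℕ → Type*}
    [∀ j, MeasurableSpace (Ω j)] {P : (j : ℕ) → Measure (Ω j)} [∀ j, IsProbabilityMeasure (P j)]
    {Y : (j : ℕ) → Ω j → ℝ}
    (h : TendstoInDistribution Y atTop (id : ℝ → ℝ) P (gaussianReal 0 1)) (x : ℝ) :
    Tendsto (fun j => (P j).real {w | Y j w ≤ x}) atTop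
      (𝓝 ((gaussianReal 0 1).real (Set.Iic x))) := by
  have hna := nullSingletonClass_gaussianReal (μ := 0) one_ne_zero
  have h1 := ProbabilityMeasure.tendsto_measure_of_null_frontier_of_tendsto' h.tendsto
    (E := Set.Iic x) (by
      rw [ProbabilityMeasure.coe_mk, Measure.map_id, frontier_Iic]
      exact measure_singleton x)
  simp only [ProbabilityMeasure.coe_mk, Measure.map_id] at h1
  refine ((ENNReal.tendsto_toReal (measure_ne_top _ _)).comp h1).congr fun j => ?_
  rw [Function.comp_apply,
    Measure.map_apply_of_aemeasurable (h.forall_aemeasurable j) measurableSet_Iic]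
  rfl

lemma setOf_standardizedOmega_le {s : ℝ} (hs : 1 < s) {Ω : Type*} (X : Ω → ℕ) (x : ℝ) :
    {w | standardizedOmega s (X w) ≤ x} =
      {w | (ArithmeticFunction.cardDistinctFactors (X w) : ℝ) - primeSum s
        ≤ x * √(primeSum s)} := by
  ext w
  exact div_le_iff₀ (Real.sqrt_pos.2 (primeSum_pos hs))

lemma tendsto_zetaDistribution_cardDistinctFactors_le (x : ℝ) :
    Tendsto (fun s : ℝ => (zetaDistribution s).real
        {m | (ArithmeticFunction.cardDistinctFactors m : ℝ) - primeSum s ≤ x * √(primeSum s)})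
      (𝓝[>] 1) (𝓝 ((gaussianReal 0 1).real (Set.Iic x))) := by
  refine tendsto_of_seq_tendsto fun u hu => ?_
  obtain ⟨hu1, hu2⟩ := tendsto_nhdsWithin_iff.1 hu
  -- Only a tail of the sequence is known to exceed `1`, so it is shifted by `N`; the identity then
  -- serves as the random variable.
  obtain ⟨N, hN⟩ := eventually_atTop.1 hu2
  rw [← tendsto_add_atTop_iff_nat N]
  have hs : ∀ j, 1 < u (j + N) := fun j => hN _ (Nat.le_add_left N j)
  have := fun j => zetaDistribution_isProbabilityMeasure (hs j)
  have h := tendsto_measureReal_Iic_of_tendstoInDistribution_gaussianReal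
    (tendstoInDistribution_standardizedOmega hs ((tendsto_add_atTop_iff_nat N).2 hu1)
      (fun j => zetaDistribution (u (j + N))) (fun _ => id) fun _ => HasLaw.id) x
  refine h.congr fun j => ?_
  rw [setOf_standardizedOmega_le (hs j)]
  rfl

theorem mainTheorem9
    (a : ℕ → ℝ) (ha_pos : ∀ j, 0 < a j) (ha : Tendsto a atTop atTop)
    {Ω : ℕ → Type*} [∀ j, MeasurableSpace (Ω j)]
    (P : (j : ℕ) → Measure (Ω j)) [∀ j, IsProbabilityMeasure (P j)]
    (X : (j : ℕ) → Ω j → ℕ)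
    (hX : ∀ j, HasLaw (X j) (zetaDistribution (1 + 1 / a j)) (P j))
    (μ : ℕ → ℝ) (hμ : ∀ j, μ j = primeSum (1 + 1 / a j)) :
    -- `∑_p p^{-(1 + 1 / a_j)}` converges, and it is the mean of `ω(X_j)`
    (∀ j, Summable (fun p : Nat.Primes => (p : ℝ) ^ (-(1 + 1 / a j))) ∧
      Integrable (fun w => (ArithmeticFunction.cardDistinctFactors (X j w) : ℝ)) (P j) ∧
      ∫ w, (ArithmeticFunction.cardDistinctFactors (X j w) : ℝ) ∂(P j) = μ j) ∧
    Tendsto μ atTop atTop ∧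
    -- convergence in distribution to a standard normal variable
    TendstoInDistribution
      (fun j w => ((ArithmeticFunction.cardDistinctFactors (X j w) : ℝ) - μ j) / √(μ j))
      atTop (id : ℝ → ℝ) P (gaussianReal 0 1) ∧
    -- the same as convergence of distribution functions
    (∀ x : ℝ, Tendsto
      (fun j => (P j).real
        {w | (ArithmeticFunction.cardDistinctFactors (X j w) : ℝ) - μ j ≤ x * √(μ j)})
      atTop (𝓝 ((gaussianReal 0 1).real (Set.Iic x)))) ∧
    -- the limit as the parameter `s` itself decreases to `1`
    (∀ x : ℝ, Tendsto
      (fun s : ℝ => (zetaDistribution s).real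
        {m | (ArithmeticFunction.cardDistinctFactors m : ℝ) - primeSum s
          ≤ x * √(primeSum s)})
      (𝓝[>] 1) (𝓝 ((gaussianReal 0 1).real (Set.Iic x)))) := by
  have hs : ∀ j, 1 < 1 + 1 / a j := fun j => by
    have := one_div_pos.2 (ha_pos j)
    linarith
  have hlim : Tendsto (fun j => 1 + 1 / a j) atTop (𝓝 1) := by
    simpa using (tendsto_const_nhds (x := (1 : ℝ))).add (tendsto_inv_atTop_zero.comp ha)
  obtain rfl : μ = fun j => primeSum (1 + 1 / a j) := funext hμ
  have hdist := tendstoInDistribution_standardizedOmega hs hlim P X hX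
  refine ⟨fun j => ⟨summable_prime_rpow_neg (hs j), ?_, ?_⟩, ?_, hdist, fun x => ?_,
    tendsto_zetaDistribution_cardDistinctFactors_le⟩
  · have h := integrable_cardDistinctFactors (hs j)
    rw [← (hX j).map_eq] at h
    exact h.comp_aemeasurable (hX j).aemeasurable
  · exact ((hX j).integral_comp (integrable_cardDistinctFactors (hs j)).aestronglyMeasurable).trans
      (integral_cardDistinctFactors (hs j))
  · exact tendsto_primeSum_atTop.comp
      (tendsto_nhdsWithin_iff.2 ⟨hlim, Eventually.of_forall hs⟩)
  · refine (tendsto_measureReal_Iic_of_tendstoInDistribution_gaussianReal hdist x).congr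
      fun j => ?_
    rw [setOf_standardizedOmega_le (hs j)]
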